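/- **Model.** A power function is a nonnegative continuous function $P$ on a set of allowed speeds $S\subseteq[0,\infty)$ with $0\in S$. A job sequence $I$ consists of finitely many jobs $j$ with release times $r(j)\ge 0$ and sizes $p(j)>0$. A schedule processes, at each time $t\ge 0$, the released jobs at nonnegative (locally integrable) rates whose sum is the speed $s(t)\in S$ (so preemption and processor sharing are allowed), never processing a job beyond its size; a job is completed at the time at which the work done on it reaches its size. The cost of a schedule is its total flow time $\sum_j (C(j)-r(j))$, where $C(j)\in[0,\infty]$ is the completion time of $j$, plus its energy $\int_0^{C} P(s(t))\,dt$, where $C=\max_j C(j)$ is the time at which all jobs are completed. A deterministic algorithm assigns a schedule to every job sequence; it is (online) nonclairvoyant if its decision at each time $t$ depends only on the jobs released up to time $t$ and their release times, and on the jobs completed up to time $t$, their completion times and their sizes. It is $c$-competitive if for every job sequence its cost is at most $c$ times the infimum of the costs of all schedules of that sequence. **Theorem.** There is a power function $P$ for which every deterministic nonclairvoyant algorithm is $\omega(1)$-competitive, that is, for which no such algorithm is $c$-competitive for any constant $c$. For example, this holds for $$P(s)=\frac{1}{(4(2-s))^{1/4}},\qquad 0\le s<2,$$ with allowed speeds $[0,2)$,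 which is nonnegative, continuous and strictly convex, tends to $\infty$ as $s\to 2^-$, and satisfies $P'(s)=P(s)^5$ for all $0\le s<2$. -/

import Mathlib

open scoped ENNReal NNReal

/-- A power function: the set of speeds at which the processor can run, and the power consumed
at each of these speeds. The values of `power` outside `speeds` are never used. -/
structure PowerFunction where
  speeds : Set ℝ
  power : ℝ → ℝ
  zero_mem : (0 : ℝ) ∈ speeds
  speeds_nonneg : ∀ s ∈ speeds, 0 ≤ s
  power_nonneg : ∀ s ∈ speeds, 0 ≤ power s
  power_continuousOn : ContinuousOn power speeds

/-- A finite job sequence: the jobs are `0, …, num - 1`, numbered in order of arrival; job `j` has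
release time `release j` and work requirement `size j`. -/
structure JobSequence where
  num : ℕ
  release : ℕ → ℝ
  size : ℕ → ℝ
  release_nonneg : ∀ j < num, 0 ≤ release j
  release_mono : ∀ i j, i ≤ j → j < num → release i ≤ release j
  size_pos : ∀ j < num, 0 < size j

/-- Job `j` exists and has been released by time `t`. -/
def JobSequence.Released (I : JobSequence) (j : ℕ) (t : ℝ) : Prop :=
  j < I.num ∧ I.release j ≤ t

/-- A (preemptive, single processor) schedule of the job sequence `I`. At time `t` the processor
works on job `j` at rate `rate j t`; its speed is the sum of these rates and has to be an allowed
one. Jobs are not processed before their release or beyond their size. A schedule is allowed to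
leave jobs unfinished for ever; it then has infinite flow time. -/
structure Schedule (P : PowerFunction) (I : JobSequence) where
  rate : ℕ → ℝ → ℝ
  rate_nonneg : ∀ j t, 0 ≤ rate j t
  rate_integrable : ∀ j t, 0 ≤ t → IntervalIntegrable (rate j) MeasureTheory.volume 0 t
  rate_eq_zero : ∀ j t, ¬ I.Released j t → rate j t = 0
  speed_mem : ∀ t, ∑ j ∈ Finset.range I.num, rate j t ∈ P.speeds
  work_le_size : ∀ j < I.num, ∀ t, 0 ≤ t → ∫ τ in (0 : ℝ)..t, rate j τ ≤ I.size j

noncomputable section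

namespace Schedule

variable {P : PowerFunction} {I : JobSequence}

/-- The speed of the processor at time `t`. -/
def speed (A : Schedule P I) (t : ℝ) : ℝ := ∑ j ∈ Finset.range I.num, A.rate j t

/-- The amount of work done on job `j` during `[0, t]`. -/
def work (A : Schedule P I) (j : ℕ) (t : ℝ) : ℝ := ∫ τ in (0 : ℝ)..t, A.rate j τ

/-- Job `j` is completed by time `t`. -/
def Completed (A : Schedule P I) (j : ℕ) (t : ℝ) : Prop :=
  I.Released j t ∧ I.size j ≤ A.work j t

/-- The time at which job `j` is completed (`∞` if this never happens). -/
def completionTime (A : Schedule P I) (j : ℕ) : ℝ≥0∞ :=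
  ⨅ (t : ℝ) (_ : A.Completed j t), ENNReal.ofReal t

/-- The flow time of job `j`: the time elapsed from its release to its completion. -/
def jobFlow (A : Schedule P I) (j : ℕ) : ℝ≥0∞ :=
  A.completionTime j - ENNReal.ofReal (I.release j)

/-- The total flow time. -/
def flow (A : Schedule P I) : ℝ≥0∞ := ∑ j ∈ Finset.range I.num, A.jobFlow j

/-- The time at which the last job is completed. -/
def makespan (A : Schedule P I) : ℝ≥0∞ := ⨆ j ∈ Finset.range I.num, A.completionTime j

/-- The total energy used from time `0` until all jobs are completed. From then on the speed is
`0` almost everywhere, so for a power function that vanishes at speed `0` this is the integral of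
the power over `[0, ∞)`. -/
def energy (A : Schedule P I) : ℝ≥0∞ :=
  ∫⁻ t in {t : ℝ | 0 ≤ t ∧ ENNReal.ofReal t < A.makespan}, ENNReal.ofReal (P.power (A.speed t))

/-- The objective: total flow time plus energy. -/
def cost (A : Schedule P I) : ℝ≥0∞ := A.flow + A.energy

end Schedule

/-- The optimal offline cost of the job sequence `I`. -/
def optCost (P : PowerFunction) (I : JobSequence) : ℝ≥0∞ := ⨅ A : Schedule P I, A.cost

/-- A deterministic scheduling algorithm produces a schedule for every job sequence. -/
abbrev Algorithm (P : PowerFunction) := (I : JobSequence) → Schedule P I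

/-- What a nonclairvoyant scheduler has seen up to time `t` is the same when `A` is run on `I` and
when it is run on `I'`: the jobs released so far and their release times, and the jobs completed
so far with the times of their completion and their sizes. -/
def Algorithm.SameHistory {P : PowerFunction} (A : Algorithm P) (I I' : JobSequence) (t : ℝ) :
    Prop :=
  (∀ j, I.Released j t ↔ I'.Released j t) ∧
  (∀ j, I.Released j t → I.release j = I'.release j) ∧
  (∀ j, ∀ τ ≤ t, (A I).Completed j τ ↔ (A I').Completed j τ) ∧
  (∀ j, (A I).Completed j t → I.size j = I'.size j)

/-- `A` is an online nonclairvoyant algorithm: its decision at any time is determined by what has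
been seen up to that time. -/
def Algorithm.IsNonclairvoyant {P : PowerFunction} (A : Algorithm P) : Prop :=
  ∀ (I I' : JobSequence) (t : ℝ), A.SameHistory I I' t → ∀ j, (A I).rate j t = (A I').rate j t

/-- `A` is `c`-competitive for total flow time plus energy. -/
def Algorithm.IsCompetitive {P : PowerFunction} (A : Algorithm P) (c : ℝ≥0) : Prop :=
  ∀ I : JobSequence, (A I).cost ≤ (c : ℝ≥0∞) * optCost P I

end

/-! The barrier makes lost work almost impossible to recover: every speed is below `2`, while speed
`v = 2 - 1 / (4 q ^ 4)` costs only power `q`.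

Release `n = q ^ 2` jobs at time `0` and choose their sizes adaptively, so that at time `T = n ^ 2`
each has exactly one unit left and nothing has been completed (`work_eq_of_work_lt`). From `T` on,
`n ^ 3` unit jobs arrive at rate `v`. Even at speed `2` the backlog of `n` units shrinks only at
rate `2 - v = 1 / (4 T)`, hence by at most `n / 4` while the stream lasts. Every job has at most one
unit left, so at least `n / 2` jobs are active for time at least `n ^ 3 / 2`, and the flow time is
at least `n ^ 4 / 4 = q ^ 8 / 4` (`ofReal_le_flow_batchThenStream`).

Offline, a batch job on which the algorithm did at least the average work is postponed to the very
end. This frees enough capacity to finish the rest of the batch by `T` at speed at most `v`, and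
each stream job is then done before the next arrives. The cost is `O(q n ^ 3) = O(q ^ 7)`
(`optCost_batchThenStream_le`), so the ratio grows like `q`. -/

/-! ### The barrier power function. -/

/-- The power needed to run at speed `s`, with a barrier at speed `2`. -/
noncomputable def barrierPower (s : ℝ) : ℝ := 1 / (4 * (2 - s)) ^ (1 / 4 : ℝ)

theorem barrierPower_nonneg {s : ℝ} (hs : s < 2) : 0 ≤ barrierPower s := by
  have : 0 < 4 * (2 - s) := by linarith
  unfold barrierPower
  positivity

theorem barrierPower_mono {s v : ℝ} (hsv : s ≤ v) (hv : v < 2) :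
    barrierPower s ≤ barrierPower v := by
  have h : 0 < 4 * (2 - v) := by linarith
  unfold barrierPower
  gcongr

theorem barrierPower_strictMonoOn : StrictMonoOn barrierPower (Set.Iio 2) := by
  intro s _ v hv hsv
  have h : 0 < 4 * (2 - v) := by have := Set.mem_Iio.1 hv; linarith
  unfold barrierPower
  gcongr

theorem barrierPower_eq {q : ℝ} (hq : 0 < q) : barrierPower (2 - 1 / (4 * q ^ 4)) = q := by
  have h : 4 * (2 - (2 - 1 / (4 * q ^ 4))) = q⁻¹ ^ (4 : ℝ) := by
    rw [show (4 : ℝ) = (4 : ℕ) by norm_num, Real.rpow_natCast]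
    field_simp
    norm_num
  rw [barrierPower, h, ← Real.rpow_mul (by positivity)]
  norm_num

theorem hasDerivAt_barrierPower {s : ℝ} (hs : s < 2) :
    HasDerivAt barrierPower (barrierPower s ^ 5) s := by
  have hpos : 0 < 4 * (2 - s) := by linarith
  have hlin : HasDerivAt (fun s : ℝ => 4 * (2 - s)) (-4) s := by
    simpa using ((hasDerivAt_id s).const_sub 2).const_mul 4
  have h := hlin.rpow_const (p := -(1 / 4 : ℝ)) (Or.inl hpos.ne')
  -- The two forms differ for negative bases under the conventions of `Real.rpow`, so they agree
  -- only locally.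
  have hev : barrierPower =ᶠ[nhds s] fun s => (4 * (2 - s)) ^ (-(1 / 4) : ℝ) := by
    filter_upwards [Iio_mem_nhds hs] with u hu
    have : 0 < 4 * (2 - u) := by have := Set.mem_Iio.1 hu; linarith
    rw [barrierPower, Real.rpow_neg this.le, one_div]
  refine (h.congr_of_eventuallyEq hev).congr_deriv ?_
  rw [hev.eq_of_nhds, ← Real.rpow_natCast, ← Real.rpow_mul hpos.le]
  norm_num

theorem strictConvexOn_barrierPower : StrictConvexOn ℝ (Set.Ico 0 2) barrierPower := by
  refine StrictMonoOn.strictConvexOn_of_deriv (convex_Ico 0 2)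
    (fun s hs => (hasDerivAt_barrierPower hs.2).continuousAt.continuousWithinAt) ?_
  rw [interior_Ico]
  intro s hs v hv hsv
  rw [(hasDerivAt_barrierPower hs.2).deriv, (hasDerivAt_barrierPower hv.2).deriv]
  exact pow_lt_pow_left₀ (barrierPower_strictMonoOn hs.2 hv.2 hsv)
    (barrierPower_nonneg hs.2) (by norm_num)

theorem tendsto_barrierPower :
    Filter.Tendsto barrierPower (nhdsWithin 2 (Set.Iio 2)) Filter.atTop := by
  refine Filter.tendsto_atTop.2 fun b => ?_
  set q : ℝ := max b 1
  have hq : 0 < q := lt_max_of_lt_right one_pos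
  have hlt : 2 - 1 / (4 * q ^ 4) < 2 := by
    have : 0 < 1 / (4 * q ^ 4) := by positivity
    linarith
  filter_upwards [Ioo_mem_nhdsLT hlt] with s hs
  calc b ≤ q := le_max_left _ _
    _ = barrierPower (2 - 1 / (4 * q ^ 4)) := (barrierPower_eq hq).symm
    _ ≤ barrierPower s := barrierPower_mono hs.1.le hs.2

/-- The power function `barrierPower` on the speeds `[0, 2)`. -/
noncomputable def barrier : PowerFunction where
  speeds := Set.Ico 0 2
  power := barrierPower
  zero_mem := by norm_num
  speeds_nonneg := fun _ hs => hs.1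
  power_nonneg := fun _ hs => barrierPower_nonneg hs.2
  power_continuousOn := fun _ hs =>
    (hasDerivAt_barrierPower hs.2).continuousAt.continuousWithinAt
-- Work, completion and flow time of arbitrary schedules.
open MeasureTheory

namespace Schedule

variable {P : PowerFunction} {I : JobSequence}

theorem intervalIntegrable_rate (A : Schedule P I) (j : ℕ) {a b : ℝ} (ha : 0 ≤ a) (hb : 0 ≤ b) :
    IntervalIntegrable (A.rate j) volume a b :=
  (A.rate_integrable j a ha).symm.trans (A.rate_integrable j b hb)

theorem work_sub_work (A : Schedule P I) (j : ℕ) {a b : ℝ} (ha : 0 ≤ a) (hb : 0 ≤ b) :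
    A.work j b - A.work j a = ∫ τ in a..b, A.rate j τ :=
  intervalIntegral.integral_interval_sub_left (A.rate_integrable j b hb)
    (A.rate_integrable j a ha)

theorem work_mono (A : Schedule P I) (j : ℕ) {a b : ℝ} (ha : 0 ≤ a) (hab : a ≤ b) :
    A.work j a ≤ A.work j b := by
  rw [← sub_nonneg, A.work_sub_work j ha (ha.trans hab)]
  exact intervalIntegral.integral_nonneg hab fun τ _ => A.rate_nonneg j τ

theorem work_zero (A : Schedule P I) (j : ℕ) : A.work j 0 = 0 :=
  intervalIntegral.integral_same

theorem work_nonneg (A : Schedule P I) (j : ℕ) {t : ℝ} (ht : 0 ≤ t) : 0 ≤ A.work j t :=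
  A.work_zero j ▸ A.work_mono j le_rfl ht

theorem work_eq_zero (A : Schedule P I) {j : ℕ} {t : ℝ} (ht : 0 ≤ t)
    (h : ∀ τ < t, ¬ I.Released j τ) : A.work j t = 0 := by
  -- Dropping the endpoint allows a job released exactly at `t`, such as the first stream job at
  -- `T`.
  rw [work, intervalIntegral.integral_of_le ht, integral_Ioc_eq_integral_Ioo]
  exact setIntegral_eq_zero_of_forall_eq_zero fun τ hτ => A.rate_eq_zero j τ (h τ hτ.2)

theorem continuousOn_work (A : Schedule P I) (j : ℕ) {t : ℝ} (ht : 0 ≤ t) :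
    ContinuousOn (A.work j) (Set.Icc 0 t) := by
  have h := intervalIntegral.continuousOn_primitive_interval' (A.rate_integrable j t ht)
    Set.left_mem_uIcc
  rwa [Set.uIcc_of_le ht] at h

theorem sum_work_le (A : Schedule P I) {v a b : ℝ} (hv : ∀ s ∈ P.speeds, s ≤ v)
    (ha : 0 ≤ a) (hab : a ≤ b) :
    ∑ j ∈ Finset.range I.num, A.work j b ≤
      ∑ j ∈ Finset.range I.num, A.work j a + v * (b - a) := by
  have hb := ha.trans hab
  rw [← sub_le_iff_le_add', ← Finset.sum_sub_distrib,
    Finset.sum_congr rfl fun j _ => A.work_sub_work j ha hb,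
    ← intervalIntegral.integral_finsetSum fun j _ => A.intervalIntegrable_rate j ha hb]
  calc ∫ τ in a..b, ∑ j ∈ Finset.range I.num, A.rate j τ ≤ ∫ _ in a..b, v := by
        refine intervalIntegral.integral_mono_on hab ?_ intervalIntegrable_const
          fun τ _ => hv _ (A.speed_mem τ)
        have := IntervalIntegrable.sum (Finset.range I.num)
          fun j _ => A.intervalIntegrable_rate j ha hb
        simpa only [Finset.sum_fn] using this
    _ = v * (b - a) := by simp [mul_comm]

theorem Completed.mono {A : Schedule P I} {j : ℕ} {t t' : ℝ} (h : A.Completed j t)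
    (htt' : t ≤ t') : A.Completed j t' :=
  ⟨⟨h.1.1, h.1.2.trans htt'⟩, h.2.trans
    (A.work_mono j ((I.release_nonneg j h.1.1).trans h.1.2) htt')⟩

theorem completionTime_le {A : Schedule P I} {j : ℕ} {t : ℝ} (h : A.Completed j t) :
    A.completionTime j ≤ ENNReal.ofReal t :=
  iInf₂_le t h

/-- Job `j` has been released but not completed by time `t`. -/
def Active (A : Schedule P I) (j : ℕ) (t : ℝ) : Prop := I.Released j t ∧ ¬ A.Completed j t

theorem ofReal_le_completionTime {A : Schedule P I} {j : ℕ} {t : ℝ} (h : ¬ A.Completed j t) :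
    ENNReal.ofReal t ≤ A.completionTime j := by
  refine le_iInf₂ fun t' ht' => ENNReal.ofReal_le_ofReal ?_
  by_contra! hlt
  exact h (ht'.mono hlt.le)

theorem volume_active_le_jobFlow (A : Schedule P I) {j : ℕ} (hj : j < I.num) :
    volume {t | A.Active j t} ≤ A.jobFlow j := by
  have hr := I.release_nonneg j hj
  rw [jobFlow]
  by_cases hC : A.completionTime j = ⊤
  · simp [hC]
  · calc volume {t | A.Active j t}
          ≤ volume (Set.Icc (I.release j) (A.completionTime j).toReal) := by
          refine measure_mono fun t ht => ⟨ht.1.2, ?_⟩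
          exact (ENNReal.ofReal_le_iff_le_toReal hC).1 (ofReal_le_completionTime ht.2)
      _ = A.completionTime j - ENNReal.ofReal (I.release j) := by
          rw [Real.volume_Icc, ENNReal.ofReal_sub _ hr, ENNReal.ofReal_toReal hC]

/-- Release and completion are both permanent, so the active times form an interval. -/
theorem measurableSet_active (A : Schedule P I) (j : ℕ) : MeasurableSet {t | A.Active j t} := by
  refine Set.OrdConnected.measurableSet ⟨fun a ha b hb t ht => ⟨⟨ha.1.1, ha.1.2.trans ht.1⟩, ?_⟩⟩
  exact fun h => hb.2 (h.mono ht.2)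

open Classical in
/-- If at least `m` jobs are active throughout `[a, b)`, the flow time is at least `m (b - a)`. -/
theorem ofReal_mul_le_flow (A : Schedule P I) {m a b : ℝ} (hab : a ≤ b)
    (h : ∀ t ∈ Set.Ico a b, m ≤ ∑ j ∈ Finset.range I.num, if A.Active j t then (1 : ℝ) else 0) :
    ENNReal.ofReal (m * (b - a)) ≤ A.flow := by
  calc ENNReal.ofReal (m * (b - a)) = ∫⁻ _ in Set.Ico a b, ENNReal.ofReal m := by
        rw [setLIntegral_const, Real.volume_Ico, ENNReal.ofReal_mul' (sub_nonneg.2 hab)]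
    _ ≤ ∫⁻ t in Set.Ico a b, ∑ j ∈ Finset.range I.num,
          {t | A.Active j t}.indicator (fun _ => (1 : ℝ≥0∞)) t := by
        refine setLIntegral_mono' measurableSet_Ico fun t ht => ?_
        refine (ENNReal.ofReal_le_ofReal (h t ht)).trans_eq ?_
        rw [ENNReal.ofReal_sum_of_nonneg fun j _ => by positivity]
        refine Finset.sum_congr rfl fun j _ => ?_
        by_cases hj : A.Active j t <;> simp [hj]
    _ = ∑ j ∈ Finset.range I.num, ∫⁻ t in Set.Ico a b,
          {t | A.Active j t}.indicator (fun _ => (1 : ℝ≥0∞)) t :=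
        lintegral_finsetSum _ fun j _ =>
          measurable_const.indicator (A.measurableSet_active j)
    _ ≤ ∑ j ∈ Finset.range I.num, A.jobFlow j := by
        refine Finset.sum_le_sum fun j hj => ?_
        rw [lintegral_indicator_const (A.measurableSet_active j), one_mul]
        exact (Measure.restrict_apply_le _ _).trans
          (A.volume_active_le_jobFlow (Finset.mem_range.1 hj))

open Classical in
/-- If every released job has at most one unit of work left, the number of active jobs is at least
the amount of released work that has not been done. -/
theorem residual_le_card_active (A : Schedule P I) {t : ℝ} (ht : 0 ≤ t)
    (h : ∀ j, I.Released j t → I.size j - A.work j t ≤ 1) :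
    (∑ j ∈ Finset.range I.num, if I.Released j t then I.size j else 0)
        - ∑ j ∈ Finset.range I.num, A.work j t
      ≤ ∑ j ∈ Finset.range I.num, if A.Active j t then (1 : ℝ) else 0 := by
  rw [← Finset.sum_sub_distrib]
  -- The bound holds job by job: a completed or unreleased job contributes at most `0` on the left,
  -- an active one at most `1`.
  refine Finset.sum_le_sum fun j _ => ?_
  by_cases hr : I.Released j t
  · by_cases hc : A.Completed j t
    · simpa [hr, Active, hc] using hc.2
    · simpa [hr, Active, hc] using h j hr
  · simpa [hr, Active] using A.work_nonneg j ht

end Schedule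

/-! ### Schedules with one constant-rate block per job. -/

theorem integral_indicator_Ico {a b c t : ℝ} (ht : 0 ≤ t) :
    ∫ τ in (0 : ℝ)..t, (Set.Ico a b).indicator (fun _ => c) τ
      = volume.real (Set.Ioc 0 t ∩ Set.Ico a b) * c := by
  rw [intervalIntegral.integral_of_le ht, setIntegral_indicator measurableSet_Ico,
    setIntegral_const, smul_eq_mul]

/-- The schedule that processes each job `j` at the constant rate `c j` during `[a j, b j)`. -/
noncomputable def blockSchedule (P : PowerFunction) (I : JobSequence) (a b c : ℕ → ℝ)
    (hc : ∀ j < I.num, 0 ≤ c j) (ha : ∀ j < I.num, I.release j ≤ a j)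
    (hab : ∀ j < I.num, a j ≤ b j) (hsize : ∀ j < I.num, (b j - a j) * c j = I.size j)
    (hspeed : ∀ t, ∑ j ∈ Finset.range I.num, (Set.Ico (a j) (b j)).indicator (fun _ => c j) t
      ∈ P.speeds) : Schedule P I where
  rate j t := if j < I.num then (Set.Ico (a j) (b j)).indicator (fun _ => c j) t else 0
  rate_nonneg j t := by
    split_ifs with hj
    · exact Set.indicator_nonneg (fun _ _ => hc j hj) t
    · rfl
  rate_integrable j t ht := by
    split_ifs with hj
    · exact (integrable_indicator_iff measurableSet_Ico).2
        (integrableOn_const (by simp)) |>.intervalIntegrable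
    · exact intervalIntegrable_const
  rate_eq_zero j t h := by
    split_ifs with hj
    · exact Set.indicator_of_notMem (fun ht => h ⟨hj, (ha j hj).trans ht.1⟩) _
    · rfl
  speed_mem t := by
    convert hspeed t using 1
    exact Finset.sum_congr rfl fun j hj => if_pos (Finset.mem_range.1 hj)
  work_le_size j hj t ht := by
    simp only [if_pos hj]
    rw [integral_indicator_Ico ht, ← hsize j hj]
    refine mul_le_mul_of_nonneg_right ?_ (hc j hj)
    refine (measureReal_mono Set.inter_subset_right (by simp)).trans_eq ?_
    rw [Real.volume_real_Ico_of_le (hab j hj)]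

section blockSchedule

variable {P : PowerFunction} {I : JobSequence} {a b c : ℕ → ℝ}
  {hc : ∀ j < I.num, 0 ≤ c j} {ha : ∀ j < I.num, I.release j ≤ a j}
  {hab : ∀ j < I.num, a j ≤ b j} {hsize : ∀ j < I.num, (b j - a j) * c j = I.size j}
  {hspeed : ∀ t, ∑ j ∈ Finset.range I.num, (Set.Ico (a j) (b j)).indicator (fun _ => c j) t
      ∈ P.speeds}

theorem blockSchedule_speed (t : ℝ) :
    (blockSchedule P I a b c hc ha hab hsize hspeed).speed t =
      ∑ j ∈ Finset.range I.num, (Set.Ico (a j) (b j)).indicator (fun _ => c j) t :=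
  Finset.sum_congr rfl fun _ hj => if_pos (Finset.mem_range.1 hj)

theorem blockSchedule_completed {j : ℕ} (hj : j < I.num) :
    (blockSchedule P I a b c hc ha hab hsize hspeed).Completed j (b j) := by
  have ha0 := (I.release_nonneg j hj).trans (ha j hj)
  refine ⟨⟨hj, (ha j hj).trans (hab j hj)⟩, ?_⟩
  simp only [Schedule.work, blockSchedule, if_pos hj]
  rw [integral_indicator_Ico (ha0.trans (hab j hj)), ← hsize j hj]
  refine mul_le_mul_of_nonneg_right ?_ (hc j hj)
  rw [← Real.volume_real_Ioo_of_le (hab j hj)]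
  exact measureReal_mono (fun t ht => ⟨⟨ha0.trans_lt ht.1, ht.2.le⟩, ht.1.le, ht.2⟩)
    (measure_ne_top_of_subset Set.inter_subset_right (by simp))

/-- All completions occur by `M`, so energy is charged only on `[0, M)`; `q` bounds the power there,
idle periods included. -/
theorem blockSchedule_cost_le {M q : ℝ} (hM : ∀ j < I.num, b j ≤ M) (hM0 : 0 ≤ M)
    (hq : ∀ t, P.power (∑ j ∈ Finset.range I.num,
      (Set.Ico (a j) (b j)).indicator (fun _ => c j) t) ≤ q) :
    (blockSchedule P I a b c hc ha hab hsize hspeed).cost ≤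
      ENNReal.ofReal (∑ j ∈ Finset.range I.num, (b j - I.release j) + q * M) := by
  set S := blockSchedule P I a b c hc ha hab hsize hspeed
  have hq0 : 0 ≤ q := (P.power_nonneg _ (hspeed 0)).trans (hq 0)
  have hbr : ∀ j < I.num, 0 ≤ b j - I.release j := fun j hj =>
    sub_nonneg.2 ((ha j hj).trans (hab j hj))
  have hcompl : ∀ j < I.num, S.completionTime j ≤ ENNReal.ofReal (b j) := fun j hj =>
    Schedule.completionTime_le (blockSchedule_completed hj)
  have hmake : S.makespan ≤ ENNReal.ofReal M := iSup₂_le fun j hj =>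
    (hcompl j (Finset.mem_range.1 hj)).trans
      (ENNReal.ofReal_le_ofReal (hM j (Finset.mem_range.1 hj)))
  rw [ENNReal.ofReal_add (Finset.sum_nonneg fun j hj => hbr j (Finset.mem_range.1 hj))
    (by positivity), Schedule.cost]
  refine add_le_add ?_ ?_
  · rw [ENNReal.ofReal_sum_of_nonneg fun j hj => hbr j (Finset.mem_range.1 hj)]
    refine Finset.sum_le_sum fun j hj => ?_
    have hj := Finset.mem_range.1 hj
    rw [ENNReal.ofReal_sub _ (I.release_nonneg j hj)]
    exact tsub_le_tsub_right (hcompl j hj) _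
  · calc S.energy ≤ ∫⁻ _ in {t : ℝ | 0 ≤ t ∧ ENNReal.ofReal t < S.makespan},
            ENNReal.ofReal q := by
          refine lintegral_mono fun t => ENNReal.ofReal_le_ofReal ?_
          rw [blockSchedule_speed]
          exact hq t
      _ ≤ ∫⁻ _ in Set.Ico 0 M, ENNReal.ofReal q := by
          refine lintegral_mono_set fun t ht => ⟨ht.1, ?_⟩
          exact (ENNReal.ofReal_lt_ofReal_iff_of_nonneg ht.1).1 (ht.2.trans_le hmake)
      _ = ENNReal.ofReal (q * M) := by
          rw [setLIntegral_const, Real.volume_Ico, sub_zero, ENNReal.ofReal_mul hq0]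

end blockSchedule

/-! ### Indistinguishable inputs and the adaptive choice of sizes. -/

/-- The input with a batch of `n` jobs of sizes `p j` at time `0`, followed by a stream of `K` unit
jobs released at the times `T, T + 1 / v, T + 2 / v, …`. -/
noncomputable def batchThenStream (n K : ℕ) (T v : ℝ) (p : ℕ → ℝ) (hT : 0 ≤ T) (hv : 0 < v)
    (hp : ∀ j < n, 0 < p j) : JobSequence where
  num := n + K
  release j := if j < n then 0 else T + ((j - n : ℕ) : ℝ) / v
  size j := if j < n then p j else 1
  release_nonneg j _ := by split_ifs <;> positivity
  release_mono i j hij _ := by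
    by_cases hj : j < n
    · simp [hj, hij.trans_lt hj]
    · by_cases hi : i < n
      · simp only [hi, hj, if_true, if_false]
        positivity
      · simp only [hi, hj, if_false]
        gcongr
  size_pos j _ := by
    split_ifs with hj
    · exact hp j hj
    · exact one_pos

section batchThenStream

variable {n K : ℕ} {T v : ℝ} {p : ℕ → ℝ} {hT : 0 ≤ T} {hv : 0 < v} {hp : ∀ j < n, 0 < p j}

theorem batchThenStream_size_of_lt {j : ℕ} (hj : j < n) :
    (batchThenStream n K T v p hT hv hp).size j = p j :=
  if_pos hj

theorem batchThenStream_size_of_not_lt {j : ℕ} (hj : ¬ j < n) :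
    (batchThenStream n K T v p hT hv hp).size j = 1 :=
  if_neg hj

/-- The right-hand side involves neither the sizes nor `K`: before `T` the releases reveal nothing
about them. -/
theorem batchThenStream_released_iff_of_lt {t : ℝ} (ht : t < T) (j : ℕ) :
    (batchThenStream n K T v p hT hv hp).Released j t ↔ j < n ∧ 0 ≤ t := by
  simp only [JobSequence.Released, batchThenStream]
  by_cases hj : j < n
  · simp [hj, hj.trans_le (Nat.le_add_right n K)]
  · have : 0 ≤ ((j - n : ℕ) : ℝ) / v := by positivity
    simp only [hj, if_false, false_and, iff_false, not_and, not_le]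
    intro _
    linarith

variable {K' : ℕ} {p' : ℕ → ℝ} {hp' : ∀ j < n, 0 < p' j} {P : PowerFunction} {A : Algorithm P}

/-- A nonclairvoyant algorithm cannot distinguish two inputs of this form as long as it has not
completed a job. -/
theorem rate_eq_of_forall_not_completed (hA : A.IsNonclairvoyant) {t : ℝ} (htT : t < T)
    (h : ∀ j, ¬ (A (batchThenStream n K T v p hT hv hp)).Completed j t)
    (h' : ∀ j, ¬ (A (batchThenStream n K' T v p' hT hv hp')).Completed j t) (j : ℕ) :
    (A (batchThenStream n K T v p hT hv hp)).rate j t =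
      (A (batchThenStream n K' T v p' hT hv hp')).rate j t := by
  refine hA _ _ t ⟨fun j => ?_, fun j hj => ?_, fun j τ hτ => ?_, fun j hj => ?_⟩ j
  · rw [batchThenStream_released_iff_of_lt htT, batchThenStream_released_iff_of_lt htT]
  · rw [batchThenStream_released_iff_of_lt htT] at hj
    simp [batchThenStream, hj.1]
  · exact iff_of_false (fun hc => h j (hc.mono hτ)) (fun hc => h' j (hc.mono hτ))
  · exact absurd hj (h j)

/-- Only times strictly before `t` matter for the integral, so `t` may itself be the first
completion time. -/
theorem work_eq_of_forall_not_completed (hA : A.IsNonclairvoyant) {t : ℝ} (ht : 0 ≤ t)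
    (htT : t ≤ T)
    (h : ∀ τ < t, ∀ j, ¬ (A (batchThenStream n K T v p hT hv hp)).Completed j τ)
    (h' : ∀ τ < t, ∀ j, ¬ (A (batchThenStream n K' T v p' hT hv hp')).Completed j τ) (j : ℕ) :
    (A (batchThenStream n K T v p hT hv hp)).work j t =
      (A (batchThenStream n K' T v p' hT hv hp')).work j t := by
  simp only [Schedule.work]
  rw [intervalIntegral.integral_of_le ht, intervalIntegral.integral_of_le ht,
    integral_Ioc_eq_integral_Ioo, integral_Ioc_eq_integral_Ioo]
  exact setIntegral_congr_fun measurableSet_Ioo fun τ hτ =>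
    rate_eq_of_forall_not_completed hA (hτ.2.trans_le htT) (h τ hτ.2) (h' τ hτ.2) j

/-- If the work done by time `T` on the first input would complete no job of either input, then the
same work is done on both inputs. -/
theorem work_eq_of_work_lt (hA : A.IsNonclairvoyant)
    (h : ∀ j < n, (A (batchThenStream n K T v p hT hv hp)).work j T < p j)
    (h' : ∀ j < n, (A (batchThenStream n K T v p hT hv hp)).work j T < p' j) (j : ℕ) :
    (A (batchThenStream n K' T v p' hT hv hp')).work j T =
      (A (batchThenStream n K T v p hT hv hp)).work j T := by
  set S := A (batchThenStream n K T v p hT hv hp) with hS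
  set S' := A (batchThenStream n K' T v p' hT hv hp') with hS'
  have hnot : ∀ τ < T, ∀ j, ¬ S.Completed j τ := by
    intro τ hτ j hc
    obtain ⟨hj, hτ0⟩ := (batchThenStream_released_iff_of_lt hτ j).1 hc.1
    have h1 : p j ≤ S.work j τ := by simpa [batchThenStream, hj] using hc.2
    exact absurd (h1.trans (S.work_mono j hτ0 hτ.le)) (h j hj).not_ge
  suffices hnot' : ∀ τ < T, ∀ j, ¬ S'.Completed j τ from
    (work_eq_of_forall_not_completed hA hT le_rfl hnot hnot' j).symm
  -- Equality of the runs is known only while neither completes a job. The first completion time of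
  -- the second run exists by compactness; the runs agree up to it, so the first run has already
  -- done work `p' j` on some `j`, against `h'`.
  by_contra! hex
  obtain ⟨τ, hτ, i, hi⟩ := hex
  have hmem : ∀ {i τ}, τ < T → S'.Completed i τ →
      τ ∈ ⋃ j ∈ Finset.range n, Set.Icc 0 T ∩ S'.work j ⁻¹' Set.Ici (p' j) := by
    intro i τ hτ hi
    obtain ⟨hin, hτ0⟩ := (batchThenStream_released_iff_of_lt hτ i).1 hi.1
    refine Set.mem_biUnion (Finset.mem_coe.2 (Finset.mem_range.2 hin)) ⟨⟨hτ0, hτ.le⟩, ?_⟩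
    simpa [batchThenStream, hin] using hi.2
  have hcomp : IsCompact
      (⋃ j ∈ Finset.range n, Set.Icc 0 T ∩ S'.work j ⁻¹' Set.Ici (p' j)) :=
    (Finset.range n).isCompact_biUnion fun j _ =>
      isCompact_Icc.of_isClosed_subset
        ((S'.continuousOn_work j hT).preimage_isClosed_of_isClosed isClosed_Icc isClosed_Ici)
        Set.inter_subset_left
  obtain ⟨t, htmem, hleast⟩ := hcomp.exists_isLeast ⟨τ, hmem hτ hi⟩
  obtain ⟨j, hj, ⟨ht0, htT⟩, hwork⟩ := Set.mem_iUnion₂.1 htmem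
  have hjn := Finset.mem_range.1 hj
  have heq := work_eq_of_forall_not_completed (A := A) (hp := hp) (hp' := hp') hA ht0 htT
    (fun τ hτ => hnot τ (hτ.trans_le htT))
    (fun τ hτ j hc => (hleast (hmem (hτ.trans_le htT) hc)).not_gt hτ) j
  have : p' j ≤ S.work j t := by rw [heq]; exact hwork
  exact absurd (this.trans (S.work_mono j ht0 htT)) (h' j hjn).not_ge

end batchThenStream

/-! ### Lower bound for the flow time of the algorithm. -/

/-- Because `k = 0` is counted, the discrete arrivals never fall behind a fluid stream of rate `v`.
-/
theorem le_sum_range_ite_cast_le (K : ℕ) {y : ℝ} (hy : y ≤ K) :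
    y ≤ ∑ k ∈ Finset.range K, if (k : ℝ) ≤ y then (1 : ℝ) else 0 := by
  induction K with
  | zero => simpa using hy
  | succ K ih =>
    rw [Finset.sum_range_succ]
    by_cases hK : y ≤ K
    · have : (0 : ℝ) ≤ if (K : ℝ) ≤ y then (1 : ℝ) else 0 := by positivity
      linarith [ih hK]
    · have hle : ∀ k ∈ Finset.range (K + 1), (k : ℝ) ≤ y := fun k hk =>
        (Nat.cast_le.2 (Nat.lt_succ_iff.1 (Finset.mem_range.1 hk))).trans (not_le.1 hK).le
      rw [← Finset.sum_range_succ (fun k : ℕ => if (k : ℝ) ≤ y then (1 : ℝ) else 0),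
        Finset.sum_congr rfl fun k hk => if_pos (hle k hk)]
      simpa using hy

open Classical in
/-- If at time `T` every job of the batch has one unit of work left, then a processor with speed at
most `u` cannot reduce the number of active jobs below `m` while the stream lasts. -/
theorem ofReal_le_flow_batchThenStream {n K : ℕ} {T v u m : ℝ} {p : ℕ → ℝ} {hT : 0 ≤ T}
    {hv : 0 < v} {hp : ∀ j < n, 0 < p j} {P : PowerFunction}
    (S : Schedule P (batchThenStream n K T v p hT hv hp)) (hu : ∀ s ∈ P.speeds, s ≤ u)
    (hvu : v ≤ u) (hw : ∀ j < n, p j = S.work j T + 1) (hm : m ≤ n - (u - v) * (K / v)) :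
    ENNReal.ofReal (m * (K / v)) ≤ S.flow := by
  have hKv : (0 : ℝ) ≤ K / v := by positivity
  rw [show (K : ℝ) / v = T + K / v - T by ring]
  refine S.ofReal_mul_le_flow (by linarith) fun t ht => ?_
  have ht0 : 0 ≤ t := hT.trans ht.1
  have hres : ∀ j, (batchThenStream n K T v p hT hv hp).Released j t →
      (batchThenStream n K T v p hT hv hp).size j - S.work j t ≤ 1 := by
    intro j _
    by_cases hj : j < n
    · have := S.work_mono j hT ht.1
      rw [batchThenStream_size_of_lt hj, hw j hj]
      linarith
    · have := S.work_nonneg j ht0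
      rw [batchThenStream_size_of_not_lt hj]
      linarith
  refine le_trans ?_ (S.residual_le_card_active ht0 hres)
  have hwork := S.sum_work_le hu hT ht.1
  have hstream : ∀ k, S.work (n + k) T = 0 := fun k => S.work_eq_zero hT fun τ hτ hr => by
    have := ((batchThenStream_released_iff_of_lt hτ _).1 hr).1
    omega
  -- Released work by time `t`: the batch exceeds the work done by `T` by `n`, and the stream has
  -- added at least `(t - T) * v`.
  have hrel : ∑ j ∈ Finset.range n, (S.work j T + 1) + (t - T) * v ≤
      ∑ j ∈ Finset.range (n + K), if (batchThenStream n K T v p hT hv hp).Released j t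
        then (batchThenStream n K T v p hT hv hp).size j else 0 := by
    rw [Finset.sum_range_add]
    refine add_le_add (le_of_eq ?_) ?_
    · refine Finset.sum_congr rfl fun j hj => ?_
      have hj := Finset.mem_range.1 hj
      simp [JobSequence.Released, batchThenStream, hj, hj.trans_le (Nat.le_add_right n K), ht0,
        hw j hj]
    · refine (le_sum_range_ite_cast_le K ?_).trans (le_of_eq ?_)
      · rw [← le_div_iff₀ hv]
        linarith [ht.2]
      · refine Finset.sum_congr rfl fun k hk => ?_
        have hk := Finset.mem_range.1 hk
        have : T + (k : ℝ) / v ≤ t ↔ (k : ℝ) ≤ (t - T) * v := by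
          rw [← div_le_iff₀ hv, le_sub_iff_add_le']
        simp [JobSequence.Released, batchThenStream, hk, this]
  have hnum : (batchThenStream n K T v p hT hv hp).num = n + K := rfl
  rw [hnum] at hwork ⊢
  rw [Finset.sum_range_add (fun j => S.work j T), Finset.sum_eq_zero fun k _ => hstream k]
    at hwork
  rw [Finset.sum_add_distrib] at hrel
  simp only [Finset.sum_const, Finset.card_range, nsmul_eq_mul, mul_one] at hrel
  have : (u - v) * (t - T) ≤ (u - v) * (K / v) :=
    mul_le_mul_of_nonneg_left (by linarith [ht.2]) (sub_nonneg.2 hvu)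
  linarith

/-! ### Upper bound for the optimal cost. -/

/-- The slots of length `1 / v` tile the stream period, so at most one stream job runs at a time. -/
theorem sum_range_indicator_Ico {v : ℝ} (hv : 0 < v) (T u t : ℝ) (K : ℕ) :
    ∑ k ∈ Finset.range K, (Set.Ico (T + (k : ℝ) / v) (T + ((k : ℝ) + 1) / v)).indicator
        (fun _ => u) t
      = (Set.Ico T (T + K / v)).indicator (fun _ => u) t := by
  induction K with
  | zero => simp
  | succ K ih =>
    have h1 : T ≤ T + K / v := by
      have : 0 ≤ (K : ℝ) / v := by positivity
      linarith
    have h2 : T + K / v ≤ T + ((K : ℝ) + 1) / v := by gcongr; linarith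
    rw [Finset.sum_range_succ, ih, Nat.cast_succ, ← Set.Ico_union_Ico_eq_Ico h1 h2,
      Set.indicator_union_of_disjoint Set.Ico_disjoint_Ico_same]

/-- The optimal schedule may postpone one job `l` of the batch until the stream has ended, and
then needs only speed `v` to complete the rest of the batch by time `T` and every job of the stream
before the release of the next one. -/
theorem optCost_batchThenStream_le {n K l : ℕ} {T v q : ℝ} {p : ℕ → ℝ} (hT : 0 < T)
    (hv : 1 ≤ v) {hp : ∀ j < n, 0 < p j} {P : PowerFunction} (hl : l < n)
    (hspeeds : Set.Icc 0 v ⊆ P.speeds) (hq : ∀ s ∈ Set.Icc 0 v, P.power s ≤ q)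
    (hsum : ∑ j ∈ Finset.range n, p j ≤ p l + v * T) :
    optCost P (batchThenStream n K T v p hT.le (one_pos.trans_le hv) hp) ≤
      ENNReal.ofReal (n * T + K / v + (1 + q) * (T + K / v + p l)) := by
  have hv0 : 0 < v := one_pos.trans_le hv
  have hpl := hp l hl
  have hKv : (0 : ℝ) ≤ K / v := by positivity
  set I := batchThenStream n K T v p hT.le hv0 hp with hI
  set D : ℝ := T + K / v with hD
  -- Batch jobs other than `l` share `[0, T)` at rates proportional to their sizes, each stream job
  -- runs alone at speed `v` for time `1 / v`, and `l` runs at speed `1` from `D` on.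
  let a : ℕ → ℝ := fun j => if j < n then if j = l then D else 0 else T + ((j - n : ℕ) : ℝ) / v
  let b : ℕ → ℝ := fun j =>
    if j < n then if j = l then D + p l else T else T + (((j - n : ℕ) : ℝ) + 1) / v
  let c : ℕ → ℝ := fun j => if j < n then if j = l then 1 else p j / T else v
  have hc : ∀ j < I.num, 0 ≤ c j := by
    intro j _
    simp only [c]
    split_ifs with h1 h2
    · exact zero_le_one
    · exact div_nonneg (hp j h1).le hT.le
    · exact hv0.le
  have ha : ∀ j < I.num, I.release j ≤ a j := by
    intro j _
    simp only [a, hI, batchThenStream]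
    split_ifs with h1 h2
    · positivity
    · exact le_rfl
    · exact le_rfl
  have hab : ∀ j < I.num, a j ≤ b j := by
    intro j _
    simp only [a, b]
    split_ifs with h1 h2
    · linarith
    · exact hT.le
    · gcongr
      linarith
  have hsize : ∀ j < I.num, (b j - a j) * c j = I.size j := by
    intro j _
    simp only [a, b, c, hI, batchThenStream]
    split_ifs with h1 h2
    · rw [h2]; ring
    · field_simp
      ring
    · field_simp
      ring
  have hstream (t : ℝ) : ∑ k ∈ Finset.range K,
      (Set.Ico (a (n + k)) (b (n + k))).indicator (fun _ => c (n + k)) t =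
        (Set.Ico T D).indicator (fun _ => v) t := by
    rw [← sum_range_indicator_Ico hv0 T v t K]
    refine Finset.sum_congr rfl fun k _ => ?_
    simp [a, b, c]
  have hspeed_le (t : ℝ) : ∑ j ∈ Finset.range I.num,
      (Set.Ico (a j) (b j)).indicator (fun _ => c j) t ≤ v := by
    have hnum : I.num = n + K := rfl
    rw [hnum, Finset.sum_range_add, hstream,
      ← Finset.add_sum_erase _ _ (Finset.mem_range.2 hl)]
    have hal : a l = D := by simp [a, hl]
    have hcl : c l = 1 := by simp [c, hl]
    have hrest : ∀ j ∈ (Finset.range n).erase l, a j = 0 ∧ b j = T ∧ c j = p j / T := by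
      intro j hj
      have h1 := Finset.mem_range.1 (Finset.mem_of_mem_erase hj)
      simp [a, b, c, h1, Finset.ne_of_mem_erase hj]
    -- Only one of the three groups runs before `T`, between `T` and `D`, or after `D`; `hsum`
    -- bounds the first speed and `1 ≤ v` the last.
    rcases lt_or_ge t T with ht | ht
    · rw [Set.indicator_of_notMem (s := Set.Ico T D) fun h => h.1.not_gt ht,
        Set.indicator_of_notMem (s := Set.Ico (a l) (b l)) fun h => by
          have := hal ▸ h.1
          linarith]
      rw [zero_add, add_zero]
      calc ∑ j ∈ (Finset.range n).erase l, (Set.Ico (a j) (b j)).indicator (fun _ => c j) t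
          ≤ ∑ j ∈ (Finset.range n).erase l, p j / T := by
            refine Finset.sum_le_sum fun j hj => ?_
            rw [← (hrest j hj).2.2]
            refine Set.indicator_le_self' (fun _ _ => ?_) t
            rw [(hrest j hj).2.2]
            exact div_nonneg (hp j (Finset.mem_range.1 (Finset.mem_of_mem_erase hj))).le hT.le
        _ ≤ v := by
            rw [← Finset.sum_div, div_le_iff₀ hT]
            have := Finset.add_sum_erase _ p (Finset.mem_range.2 hl)
            linarith
    · rw [Finset.sum_eq_zero (s := (Finset.range n).erase l) fun j hj =>
        Set.indicator_of_notMem (fun h => by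
          have := (hrest j hj).2.1 ▸ h.2
          linarith) _, add_zero, hcl]
      rcases lt_or_ge t D with htD | htD
      · rw [Set.indicator_of_notMem (s := Set.Ico (a l) (b l)) fun h =>
          (hal ▸ h.1).not_gt htD, zero_add]
        exact Set.indicator_le_self' (fun _ _ => hv0.le) t
      · rw [Set.indicator_of_notMem (s := Set.Ico T D) fun h => h.2.not_ge htD, add_zero]
        exact (Set.indicator_le_self' (fun _ _ => zero_le_one) t).trans hv
  have hspeed (t : ℝ) : ∑ j ∈ Finset.range I.num,
      (Set.Ico (a j) (b j)).indicator (fun _ => c j) t ∈ Set.Icc 0 v :=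
    ⟨Finset.sum_nonneg fun j hj =>
      Set.indicator_nonneg (fun _ _ => hc j (Finset.mem_range.1 hj)) t, hspeed_le t⟩
  refine (iInf_le _ (blockSchedule P I a b c hc ha hab hsize fun t => hspeeds (hspeed t))).trans ?_
  refine (blockSchedule_cost_le (M := D + p l) (q := q) ?_ (by positivity)
    fun t => hq _ (hspeed t)).trans (ENNReal.ofReal_le_ofReal ?_)
  · intro j hj
    simp only [b]
    split_ifs with h1 h2
    · exact le_rfl
    · linarith
    · have : (((j - n : ℕ) : ℝ) + 1) / v ≤ K / v := by
        gcongr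
        have hj : j < n + K := hj
        have : j - n + 1 ≤ K := by omega
        exact_mod_cast this
      linarith
  · have hflow : ∑ j ∈ Finset.range I.num, (b j - I.release j) ≤
        (n * T + (D + p l)) + K / v := by
      have hnum : I.num = n + K := rfl
      rw [hnum, Finset.sum_range_add]
      refine add_le_add ?_ (le_of_eq ?_)
      · rw [← Finset.add_sum_erase _ _ (Finset.mem_range.2 hl), add_comm]
        refine add_le_add ?_ ?_
        · calc ∑ j ∈ (Finset.range n).erase l, (b j - I.release j)
              = ∑ _ ∈ (Finset.range n).erase l, T := by
                refine Finset.sum_congr rfl fun j hj => ?_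
                have h1 := Finset.mem_range.1 (Finset.mem_of_mem_erase hj)
                simp [b, hI, batchThenStream, h1, Finset.ne_of_mem_erase hj]
            _ ≤ ∑ j ∈ Finset.range n, T :=
                Finset.sum_le_sum_of_subset_of_nonneg (Finset.erase_subset _ _)
                  fun _ _ _ => hT.le
            _ = n * T := by simp
        · simp [b, hI, batchThenStream, hl]
      · calc ∑ k ∈ Finset.range K, (b (n + k) - I.release (n + k))
            = ∑ k ∈ Finset.range K, 1 / v := by
              refine Finset.sum_congr rfl fun k _ => ?_
              simp only [b, hI, batchThenStream, Nat.not_lt.2 (Nat.le_add_right n k), if_false,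
                Nat.add_sub_cancel_left]
              ring
          _ = K / v := by simp [div_eq_mul_inv]
    linarith

/-! ### Choice of parameters and the unbounded ratio. -/

/-- On a suitable input every nonclairvoyant algorithm pays at least `q / 48` times the optimum. -/
theorem exists_input_lower_bound {A : Algorithm barrier} (hA : A.IsNonclairvoyant) {q : ℕ}
    (hq : 0 < q) :
    ∃ I, ENNReal.ofReal ((q : ℝ) ^ 8 / 4) ≤ (A I).cost ∧
      optCost barrier I ≤ ENNReal.ofReal (12 * (q : ℝ) ^ 7) := by
  set n := q ^ 2 with hn
  set T : ℝ := (n : ℝ) ^ 2 with hTdef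
  -- The speed of power exactly `q`. As `T = q ^ 4`, its gap to the barrier costs only `1 / 4` unit
  -- of work during `[0, T]`.
  set v : ℝ := 2 - 1 / (4 * (q : ℝ) ^ 4) with hvdef
  have hq1 : (1 : ℝ) ≤ q := by exact_mod_cast hq
  have hnq : (n : ℝ) = (q : ℝ) ^ 2 := by simp [hn]
  have hn1 : (1 : ℝ) ≤ n := by rw [hnq]; exact one_le_pow₀ hq1
  have hn0 : 0 < n := by positivity
  have hT : 0 < T := by positivity
  have hδ0 : 0 < 1 / (4 * (q : ℝ) ^ 4) := by positivity
  have hδT : 1 / (4 * (q : ℝ) ^ 4) * T = 1 / 4 := by rw [hTdef, hnq]; field_simp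
  have hT1 : 1 ≤ T := one_le_pow₀ hn1
  have hδ : 1 / (4 * (q : ℝ) ^ 4) ≤ 1 / 4 := by nlinarith
  have hv1 : 1 ≤ v := by linarith
  have hv0 : 0 < v := by linarith
  have hv2 : v < 2 := by linarith
  have hspeed : ∀ s ∈ barrier.speeds, s ≤ 2 := fun s hs => hs.2.le
  -- A probe: jobs too large to be completed by `T` at speeds below `2` reveal the work `x j` from
  -- which the true sizes are built.
  set p₀ : ℕ → ℝ := fun _ => 2 * T + 1
  have hp₀ : ∀ j < n, 0 < p₀ j := fun j _ => by positivity
  set S₀ := A (batchThenStream n 0 T v p₀ hT.le hv0 hp₀)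
  set x : ℕ → ℝ := fun j => S₀.work j T
  have hx0 : ∀ j, 0 ≤ x j := fun j => S₀.work_nonneg j hT.le
  have hxsum : ∑ j ∈ Finset.range n, x j ≤ 2 * T := by
    have := S₀.sum_work_le hspeed le_rfl hT.le
    simp only [Schedule.work_zero, Finset.sum_const_zero, zero_add, sub_zero] at this
    exact this
  have hxle : ∀ j < n, x j ≤ 2 * T := fun j hj =>
    (Finset.single_le_sum (fun j _ => hx0 j) (Finset.mem_range.2 hj)).trans hxsum
  set p : ℕ → ℝ := fun j => x j + 1 with hpdef
  have hp : ∀ j < n, 0 < p j := fun j _ => by linarith [hx0 j]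
  set S := A (batchThenStream n (n ^ 3) T v p hT.le hv0 hp)
  have hwork : ∀ j, S.work j T = x j := work_eq_of_work_lt hA
    (fun j hj => by linarith [hxle j hj]) (fun j _ => by linarith)
  -- The postponed job is one whose work is at least the average.
  obtain ⟨l, hl, hlmax⟩ := Finset.exists_le_of_sum_le (s := Finset.range n)
    (f := fun _ => (∑ j ∈ Finset.range n, x j) / n) (g := x) ⟨0, Finset.mem_range.2 hn0⟩
    (le_of_eq (by simp; field_simp))
  have hln := Finset.mem_range.1 hl
  have hKv : ((n ^ 3 : ℕ) : ℝ) / v ≤ (n : ℝ) ^ 3 := by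
    push_cast
    exact div_le_self (by positivity) hv1
  have hKv' : (n : ℝ) ^ 3 / 2 ≤ ((n ^ 3 : ℕ) : ℝ) / v := by
    push_cast
    gcongr
  refine ⟨batchThenStream n (n ^ 3) T v p hT.le hv0 hp, ?_, ?_⟩
  · refine le_trans (le_trans (ENNReal.ofReal_le_ofReal ?_)
      (ofReal_le_flow_batchThenStream S (m := n / 2) hspeed hv2.le
        (fun j _ => by rw [hwork]) ?_)) le_self_add
    · calc (q : ℝ) ^ 8 / 4 = n / 2 * ((n : ℝ) ^ 3 / 2) := by rw [hnq]; ring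
        _ ≤ _ := by gcongr
    · have : (2 - v) * (((n ^ 3 : ℕ) : ℝ) / v) ≤ (2 - v) * (n : ℝ) ^ 3 :=
        mul_le_mul_of_nonneg_left hKv (by linarith)
      have h2 : (2 - v) * (n : ℝ) ^ 3 = n / 4 := by
        calc (2 - v) * (n : ℝ) ^ 3 = (1 / (4 * (q : ℝ) ^ 4) * T) * n := by
              rw [hvdef, hTdef]; ring
          _ = (n : ℝ) / 4 := by rw [hδT]; ring
      linarith
  · refine (optCost_batchThenStream_le (P := barrier) (q := q) hT hv1 hln
      (fun s hs => ⟨hs.1, hs.2.trans_lt hv2⟩) (fun s hs => ?_) ?_).trans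
      (ENNReal.ofReal_le_ofReal ?_)
    · exact (barrierPower_mono hs.2 hv2).trans_eq (barrierPower_eq (by positivity))
    · have hvT : v * T = 2 * T - 1 / 4 := by rw [hvdef, sub_mul, hδT]
      have havg : ∑ j ∈ Finset.range n, x j - (∑ j ∈ Finset.range n, x j) / n
          ≤ 2 * T - 2 * n := by
        calc _ = (∑ j ∈ Finset.range n, x j) * (1 - 1 / n) := by ring
          _ ≤ 2 * T * (1 - 1 / n) := by
              refine mul_le_mul_of_nonneg_right hxsum (sub_nonneg.2 ?_)
              rw [div_le_one (by positivity)]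
              exact hn1
          _ = 2 * T - 2 * n := by rw [hTdef]; field_simp
      simp only [hpdef, Finset.sum_add_distrib, Finset.sum_const, Finset.card_range,
        nsmul_eq_mul, mul_one]
      linarith
    · have hpl : p l ≤ 2 * T + 1 := by linarith [hxle l hln]
      have hT3 : T ≤ (n : ℝ) ^ 3 := pow_le_pow_right₀ hn1 (by norm_num)
      -- The first two terms are at most `n ^ 3` each, and `p l ≤ 2 * T + 1 ≤ 3 * n ^ 3`.
      have hM : T + ((n ^ 3 : ℕ) : ℝ) / v + p l ≤ 5 * (n : ℝ) ^ 3 := by linarith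
      have hnT : n * T = (n : ℝ) ^ 3 := by rw [hTdef]; ring
      calc _ ≤ (n : ℝ) ^ 3 + (n : ℝ) ^ 3 + (1 + q) * (5 * (n : ℝ) ^ 3) := by
            rw [hnT]
            gcongr
        _ = (7 + 5 * q) * (n : ℝ) ^ 3 := by ring
        _ ≤ (12 * q) * (n : ℝ) ^ 3 := by
            gcongr
            linarith
        _ = 12 * (q : ℝ) ^ 7 := by rw [hnq]; ring

theorem not_isCompetitive_barrier {A : Algorithm barrier} (hA : A.IsNonclairvoyant) (c : ℝ≥0) :
    ¬ A.IsCompetitive c := by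
  intro hc
  obtain ⟨q, hq⟩ := exists_nat_gt (48 * (c : ℝ))
  have hq0 : (0 : ℝ) < q := lt_of_le_of_lt (by positivity) hq
  obtain ⟨I, hlow, hopt⟩ := exists_input_lower_bound hA (Nat.cast_pos.1 hq0)
  have h : ENNReal.ofReal ((q : ℝ) ^ 8 / 4) ≤ ENNReal.ofReal (c * (12 * (q : ℝ) ^ 7)) := by
    rw [ENNReal.ofReal_mul c.coe_nonneg, ENNReal.ofReal_coe_nnreal]
    exact hlow.trans ((hc I).trans (mul_le_mul_right hopt _))
  rw [ENNReal.ofReal_le_ofReal_iff (by positivity)] at h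
  have h7 : 0 < (q : ℝ) ^ 7 := by positivity
  nlinarith

theorem theorem3 :
    ∃ P : PowerFunction,
      P.speeds = Set.Ico 0 2 ∧
      (∀ s ∈ Set.Ico (0 : ℝ) 2, P.power s = 1 / (4 * (2 - s)) ^ (1 / 4 : ℝ)) ∧
      (∀ s ∈ Set.Ico (0 : ℝ) 2, HasDerivWithinAt P.power (P.power s ^ 5) (Set.Ico 0 2) s) ∧
      StrictConvexOn ℝ (Set.Ico 0 2) P.power ∧
      Filter.Tendsto P.power (nhdsWithin 2 (Set.Iio 2)) Filter.atTop ∧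
      ∀ A : Algorithm P, A.IsNonclairvoyant → ∀ c : ℝ≥0, ¬ A.IsCompetitive c := by
  exact ⟨barrier, rfl, fun _ _ => rfl,
    fun _ hs => (hasDerivAt_barrierPower hs.2).hasDerivWithinAt, strictConvexOn_barrierPower,
    tendsto_barrierPower, fun _ hA c => not_isCompetitive_barrier hA c⟩
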